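/- Let $G$ be a group. A subset of $G$ is *elementary algebraic* if it has the form $\{x\in G : x^{\varepsilon_1}a_1x^{\varepsilon_2}a_2\cdots a_{n-1}x^{\varepsilon_n}=a_n\}$ for some integer $n>0$, $a_1,\dots,a_n\in G$ and $\varepsilon_1,\dots,\varepsilon_n\in\{-1,1\}$. The *Zariski topology* $\mathfrak Z_G$ is the topology on $G$ whose closed sets are the intersections of (possibly empty) finite unions of elementary algebraic subsets of $G$. The *Markov topology* $\mathfrak M_G$ is the topology on $G$ whose closed sets are the subsets of $G$ that are closed in every Hausdorff group topology on $G$. A subgroup $N$ of $G$ is *Markov embedded in $G$* if $\mathfrak M_N$ coincides with the subspace topology induced on $N$ by $\mathfrak M_G$. Let $[G]^{\le\omega}$ be the set of all at most countable subsets of $G$. A family $\mathcal C\subseteq[G]^{\le\omega}$ is a *club in $[G]^{\le\omega}$* if $\bigcup_{n\in\mathbb N}C_n\in\mathcal C$ whenever $C_0\subseteq C_1\subseteq C_2\subseteq\cdots$ are members of $\mathcal C$, and every $Y\in[G]^{\le\omega}$ is contained in some member of $\mathcal C$. Suppose that the family of all at most countable subgroups $N$ of $G$ that are Markov embedded in $G$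 contains some club in $[G]^{\le\omega}$. Then $\mathfrak M_G=\mathfrak Z_G$. -/

import Mathlib

/-- `S ⊆ G` is elementary algebraic: it is the solution set
`{x | x ^ ε 0 * a 0 * x ^ ε 1 * a 1 * ⋯ * a (n - 1) * x ^ ε n = a n}` of a single equation,
with coefficients `a 0, …, a n ∈ G` and exponents `ε 0, …, ε n ∈ {-1, 1}` (with `n + 1 > 0`
coefficients in all). -/
def IsElementaryAlgebraic {G : Type*} [Group G] (S : Set G) : Prop :=
  ∃ (n : ℕ) (a : Fin (n + 1) → G) (ε : Fin (n + 1) → ℤ),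
    (∀ i, ε i = 1 ∨ ε i = -1) ∧
    S = {x : G | (List.ofFn fun i : Fin n => x ^ ε i.castSucc * a i.castSucc).prod *
      x ^ ε (Fin.last n) = a (Fin.last n)}

/-- `S` is a (possibly empty) finite union of elementary algebraic sets. -/
def IsFiniteUnionOfElementaryAlgebraic {G : Type*} [Group G] (S : Set G) : Prop :=
  ∃ F : Set (Set G), F.Finite ∧ (∀ E ∈ F, IsElementaryAlgebraic E) ∧ S = ⋃₀ F

/-- `S` is algebraic: an intersection of finite unions of elementary algebraic sets.
The empty intersection is the whole group. -/
def IsAlgebraicSet {G : Type*} [Group G] (S : Set G) : Prop :=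
  ∃ A : Set (Set G), (∀ E ∈ A, IsFiniteUnionOfElementaryAlgebraic E) ∧ S = ⋂₀ A

/-- `t` is a Hausdorff group topology on `G`. -/
def IsHausdorffGroupTopology {G : Type*} [Group G] (t : TopologicalSpace G) : Prop :=
  @IsTopologicalGroup G t _ ∧ @T2Space G t

/-- `S` is unconditionally closed: closed in every Hausdorff group topology on `G`. -/
def IsUnconditionallyClosed {G : Type*} [Group G] (S : Set G) : Prop :=
  ∀ t : TopologicalSpace G, IsHausdorffGroupTopology t → @IsClosed G t S

theorem isAlgebraicSet_empty {G : Type*} [Group G] : IsAlgebraicSet (∅ : Set G) :=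
  ⟨{∅}, by rintro E rfl; exact ⟨∅, Set.finite_empty, by simp, by simp⟩, by simp⟩

theorem isAlgebraicSet_sInter {G : Type*} [Group G] (B : Set (Set G))
    (hB : ∀ S ∈ B, IsAlgebraicSet S) : IsAlgebraicSet (⋂₀ B) := by
  choose! A hA hS using hB
  refine ⟨⋃ S ∈ B, A S, ?_, ?_⟩
  · intro E hE
    simp only [Set.mem_iUnion] at hE
    obtain ⟨S, hSB, hE⟩ := hE
    exact hA S hSB E hE
  · ext x
    simp only [Set.mem_sInter, Set.mem_iUnion]
    constructor
    · rintro h E ⟨S, hSB, hE⟩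
      have hx := h S hSB
      rw [hS S hSB] at hx
      exact hx E hE
    · intro h S hSB
      rw [hS S hSB]
      exact fun E hE => h E ⟨S, hSB, hE⟩

theorem isAlgebraicSet_union {G : Type*} [Group G] {S T : Set G}
    (hS : IsAlgebraicSet S) (hT : IsAlgebraicSet T) : IsAlgebraicSet (S ∪ T) := by
  obtain ⟨A, hA, rfl⟩ := hS
  obtain ⟨B, hB, rfl⟩ := hT
  refine ⟨{E | ∃ P ∈ A, ∃ Q ∈ B, E = P ∪ Q}, ?_, ?_⟩
  · rintro E ⟨P, hP, Q, hQ, rfl⟩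
    obtain ⟨F, hF, hF', rfl⟩ := hA P hP
    obtain ⟨F₂, hF₂, hF₂', rfl⟩ := hB Q hQ
    refine ⟨F ∪ F₂, hF.union hF₂, ?_, (Set.sUnion_union F F₂).symm⟩
    rintro E (hE | hE)
    · exact hF' E hE
    · exact hF₂' E hE
  · ext x
    constructor
    · rintro (hx | hx)
      · rintro E ⟨P, hP, Q, hQ, rfl⟩
        exact Or.inl (hx P hP)
      · rintro E ⟨P, hP, Q, hQ, rfl⟩
        exact Or.inr (hx Q hQ)
    · intro h
      by_contra hx
      simp only [Set.mem_union, Set.mem_sInter, not_or, not_forall] at hx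
      obtain ⟨⟨P, hP, hxP⟩, Q, hQ, hxQ⟩ := hx
      rcases h (P ∪ Q) ⟨P, hP, Q, hQ, rfl⟩ with h | h
      · exact hxP h
      · exact hxQ h

/-- The Zariski topology of `G`: the closed sets are the algebraic sets. -/
@[reducible] def zariskiTopology (G : Type*) [Group G] : TopologicalSpace G :=
  TopologicalSpace.ofClosed {S : Set G | IsAlgebraicSet S} isAlgebraicSet_empty
    (fun B hB => isAlgebraicSet_sInter B hB) (fun _ hS _ hT => isAlgebraicSet_union hS hT)

/-- The Markov topology of `G`: the closed sets are the unconditionally closed sets. -/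
@[reducible] def markovTopology (G : Type*) [Group G] : TopologicalSpace G :=
  TopologicalSpace.ofClosed {S : Set G | IsUnconditionallyClosed S}
    (fun t _ => @isClosed_empty G t)
    (fun _ hB t ht => @isClosed_sInter G t _ fun _ hS => hB hS t ht)
    (fun _ hS _ hT t ht => @IsClosed.union G _ _ t (hS t ht) (hT t ht))

/-- The subgroup `H` is Markov embedded in `G`: the Markov topology of `H` coincides with the
subspace topology induced on `H` by the Markov topology of `G`. -/
def IsMarkovEmbedded {G : Type*} [Group G] (H : Subgroup G) : Prop :=
  markovTopology H = TopologicalSpace.induced (Subtype.val : H → G) (markovTopology G)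

/-- `C` is a club (a closed and unbounded family) in the family `[X]^{≤ω}` of all at most
countable subsets of `X`. -/
structure IsClubOfCountableSets {X : Type*} (C : Set (Set X)) : Prop where
  countable : ∀ Y ∈ C, Y.Countable
  closed : ∀ Y : ℕ → Set X, (∀ n, Y n ∈ C) → (∀ n, Y n ⊆ Y (n + 1)) → (⋃ n, Y n) ∈ C
  unbounded : ∀ Y : Set X, Y.Countable → ∃ Z ∈ C, Y ⊆ Z

/-- The family of all (carriers of) at most countable subgroups of `G` that are Markov embedded
in `G`. -/
def countableMarkovEmbedded (G : Type*) [Group G] : Set (Set G) :=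
  {S : Set G | S.Countable ∧ ∃ N : Subgroup G, (N : Set G) = S ∧ IsMarkovEmbedded N}

/-! Equations define closed sets in every Hausdorff group topology, so only one direction is hard.
Suppose `S` is unconditionally closed and `x ∉ S` lies in every finite union of elementary algebraic
sets containing `S`. Let `w` send each finite family of elementary algebraic sets missing `x` to a
point of `S` outside its union. Closing off along the club
(`IsClubOfCountableSets.exists_closed_under`) gives a countable Markov embedded `N` containing `x`
and closed under `w` for families with coefficients in `N`. Then `S ∩ N` is unconditionally closed
in `N`, hence algebraic by Markov's theorem, so some such family covers `S ∩ N` and misses `x`; its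
value under `w` is a contradiction.

Markov's theorem: if `x₀` is in the Zariski closure of `S` in a countable group, `exists_letters`
picks points `x₀ * b m` of `S` one at a time, so that `b` converges to `1` in a Hausdorff group
topology. Hence `x₀` is in the closure of `S`, which is `S`. -/

/-! ### Algebraic sets are unconditionally closed -/

section Topologies

variable {G : Type*} [Group G]

theorem isClosed_zariskiTopology_iff {S : Set G} :
    @IsClosed G (zariskiTopology G) S ↔ IsAlgebraicSet S := by
  rw [← @isOpen_compl_iff G S (zariskiTopology G)]
  change IsAlgebraicSet Sᶜᶜ ↔ _
  rw [compl_compl]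

theorem isClosed_markovTopology_iff {S : Set G} :
    @IsClosed G (markovTopology G) S ↔ IsUnconditionallyClosed S := by
  rw [← @isOpen_compl_iff G S (markovTopology G)]
  change IsUnconditionallyClosed Sᶜᶜ ↔ _
  rw [compl_compl]

theorem IsElementaryAlgebraic.isAlgebraicSet {S : Set G} (hS : IsElementaryAlgebraic S) :
    IsAlgebraicSet S :=
  ⟨{S}, by
    rintro E rfl
    exact ⟨{E}, Set.finite_singleton E, by rintro F rfl; exact hS, by simp⟩, by simp⟩

theorem isAlgebraicSet_univ : IsAlgebraicSet (Set.univ : Set G) :=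
  ⟨∅, by simp, by simp⟩

/-- Elementary algebraic sets are closed in every Hausdorff group topology. -/
theorem IsElementaryAlgebraic.isUnconditionallyClosed {S : Set G}
    (hS : IsElementaryAlgebraic S) : IsUnconditionallyClosed S := by
  obtain ⟨n, a, ε, -, rfl⟩ := hS
  intro t ht
  have := ht.1
  have := ht.2
  refine isClosed_eq (Continuous.mul ?_ (continuous_zpow _)) continuous_const
  have h (x : G) : (List.ofFn fun i : Fin n => x ^ ε i.castSucc * a i.castSucc).prod =
      ((List.finRange n).map fun i : Fin n => x ^ ε i.castSucc * a i.castSucc).prod := by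
    rw [List.ofFn_eq_map]
  simp only [h]
  exact continuous_list_prod _ fun i _ => (continuous_zpow _).mul continuous_const

theorem IsAlgebraicSet.isUnconditionallyClosed {S : Set G} (hS : IsAlgebraicSet S) :
    IsUnconditionallyClosed S := by
  obtain ⟨A, hA, rfl⟩ := hS
  intro t ht
  refine isClosed_sInter fun E hE => ?_
  obtain ⟨F, hF, hF', rfl⟩ := hA E hE
  rw [Set.sUnion_eq_biUnion]
  exact hF.isClosed_biUnion fun i hi => (hF' i hi).isUnconditionallyClosed t ht

end Topologies

/-! ### Equations between one-variable words and constants -/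

section WordFunctions

/-- The functions `G → G` given by words in one variable with coefficients in `G`. -/
def wordFunctions (G : Type*) [Group G] : Subgroup (G → G) :=
  Subgroup.closure (insert id (Set.range (Function.const G)))

variable {G : Type*} [Group G]

theorem id_mem_wordFunctions : (id : G → G) ∈ wordFunctions G :=
  Subgroup.subset_closure (Set.mem_insert _ _)

theorem const_mem_wordFunctions (c : G) : Function.const G c ∈ wordFunctions G :=
  Subgroup.subset_closure (Set.mem_insert_of_mem _ ⟨c, rfl⟩)

theorem exists_list_of_mem_wordFunctions {f : G → G} (hf : f ∈ wordFunctions G) :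
    ∃ (b : G) (L : List (ℤ × G)), (∀ p ∈ L, p.1 = 1 ∨ p.1 = -1) ∧
      ∀ x, f x = b * (L.map fun p => x ^ p.1 * p.2).prod := by
  rw [wordFunctions, ← Subgroup.mem_toSubmonoid, Subgroup.closure_toSubmonoid] at hf
  induction hf using Submonoid.closure_induction_left with
  | one => exact ⟨1, [], by simp, by simp⟩
  | mul_left u hu v _ ih =>
    obtain ⟨b, L, hL, hv⟩ := ih
    rcases hu with (rfl | ⟨c, rfl⟩) | (hu | ⟨c, hu⟩)
    · refine ⟨1, (1, b) :: L, ?_, fun x => by simp [hv, mul_assoc]⟩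
      simpa using hL
    · exact ⟨c * b, L, hL, fun x => by simp [hv, mul_assoc]⟩
    · refine ⟨1, (-1, b) :: L, ?_, fun x => ?_⟩
      · simpa using hL
      · obtain rfl : u = id⁻¹ := by rw [← hu, inv_inv]
        simp [hv, mul_assoc]
    · refine ⟨c⁻¹ * b, L, hL, fun x => ?_⟩
      obtain rfl : u = (Function.const G c)⁻¹ := by rw [hu, inv_inv]
      simp [hv, mul_assoc]

theorem isAlgebraicSet_setOf_wordFunction_eq {f : G → G} (hf : f ∈ wordFunctions G) (c : G) :
    IsAlgebraicSet {x | f x = c} := by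
  obtain ⟨b, L, hL, hf⟩ := exists_list_of_mem_wordFunctions hf
  simp only [hf]
  rcases List.eq_nil_or_concat L with rfl | ⟨L, ⟨e, a⟩, rfl⟩
  · by_cases h : b = c
    · simpa [h] using isAlgebraicSet_univ
    · simpa [h] using isAlgebraicSet_empty
  -- An elementary equation starts and ends with a power of `x`, so the outer constants `b` and `a`
  -- move to the right-hand side.
  · refine IsElementaryAlgebraic.isAlgebraicSet ⟨L.length,
      Fin.snoc (α := fun _ => G) (fun i => (L.get i).2) (b⁻¹ * c * a⁻¹),
      Fin.snoc (α := fun _ => ℤ) (fun i => (L.get i).1) e, ?_, ?_⟩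
    · intro i
      refine Fin.lastCases ?_ (fun i => ?_) i
      · simpa using hL (e, a) (by simp)
      · simpa using hL (L.get i) (by simp)
    · ext x
      have h : (List.ofFn fun i : Fin L.length => x ^ (L.get i).1 * (L.get i).2) =
          L.map fun p => x ^ p.1 * p.2 := by
        conv_rhs => rw [← List.ofFn_get L, List.map_ofFn]
        rfl
      simp only [Fin.snoc_castSucc, Fin.snoc_last, Set.mem_ofPred_eq, h, List.concat_eq_append,
        List.map_append, List.prod_append, List.map_cons, List.map_nil, List.prod_singleton]
      rw [eq_mul_inv_iff_mul_eq, eq_inv_mul_iff_mul_eq]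
      simp only [mul_assoc]

end WordFunctions

/-! ### Finite approximations to neighborhoods of the identity -/

section NbhdApprox

/-- The elements obtained from the letters `b n, …, b (n + d - 1)` in at most `d` steps, where the
`n`-th stage is the set of products of two elements, and of conjugates by `g 0, …, g n` of
elements, of the `(n + 1)`-st stage, together with `1` and `(b n)⁻¹` and `b n`. -/
def nbhdApprox {H : Type*} [Group H] (g b : ℕ → H) : ℕ → ℕ → Set H
  | 0, _ => {1}
  | d + 1, n => {1, b n, (b n)⁻¹} ∪
      Set.image2 (· * ·) (nbhdApprox g b d (n + 1)) (nbhdApprox g b d (n + 1)) ∪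
      ⋃ i ∈ Set.Iic n, (fun x => g i * x * (g i)⁻¹) '' nbhdApprox g b d (n + 1)

variable {H K : Type*} [Group H] [Group K] (g b : ℕ → H)

theorem one_mem_nbhdApprox (d n : ℕ) : 1 ∈ nbhdApprox g b d n := by
  cases d <;> simp [nbhdApprox]

theorem nbhdApprox_finite (d n : ℕ) : (nbhdApprox g b d n).Finite := by
  induction d generalizing n with
  | zero => simp [nbhdApprox]
  | succ d ih =>
    exact ((Set.toFinite _).union ((ih _).image2 _ (ih _))).union
      ((Set.finite_Iic n).biUnion fun i _ => (ih _).image _)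

theorem nbhdApprox_subset_succ (d n : ℕ) : nbhdApprox g b d n ⊆ nbhdApprox g b (d + 1) n := by
  induction d generalizing n with
  | zero => rintro _ rfl; exact one_mem_nbhdApprox g b _ _
  | succ d ih =>
    exact Set.union_subset_union (Set.union_subset_union_right _ (Set.image2_subset (ih _) (ih _)))
      (Set.iUnion₂_mono fun i _ => Set.image_mono (ih _))

theorem nbhdApprox_mono (n : ℕ) : Monotone fun d => nbhdApprox g b d n :=
  monotone_nat_of_le_succ fun d => nbhdApprox_subset_succ g b d n

theorem antitone_iUnion_nbhdApprox : Antitone fun n => ⋃ d, nbhdApprox g b d n := by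
  refine antitone_nat_of_succ_le fun n => Set.iUnion_subset fun d x hx => ?_
  exact Set.mem_iUnion.2 ⟨d + 1, Or.inl (Or.inr
    ⟨x, hx, 1, one_mem_nbhdApprox g b _ _, mul_one x⟩)⟩

theorem inv_mem_nbhdApprox {d n : ℕ} {x : H} (hx : x ∈ nbhdApprox g b d n) :
    x⁻¹ ∈ nbhdApprox g b d n := by
  induction d generalizing n x with
  | zero => simpa [nbhdApprox] using hx
  | succ d ih =>
    rcases hx with ((rfl | rfl | rfl) | ⟨y, hy, z, hz, rfl⟩) | hx
    · simp [nbhdApprox]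
    · simp [nbhdApprox]
    · simp [nbhdApprox]
    · exact Or.inl (Or.inr ⟨z⁻¹, ih hz, y⁻¹, ih hy, (mul_inv_rev y z).symm⟩)
    · simp only [Set.mem_iUnion] at hx
      obtain ⟨i, hi, y, hy, rfl⟩ := hx
      refine Or.inr (Set.mem_biUnion hi ⟨y⁻¹, ih hy, ?_⟩)
      simp [mul_assoc]

theorem nbhdApprox_subset_subgroup (P : Subgroup H) (hg : ∀ i, g i ∈ P) (hb : ∀ i, b i ∈ P)
    (d n : ℕ) : nbhdApprox g b d n ⊆ P := by
  induction d generalizing n with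
  | zero => rintro _ rfl; exact P.one_mem
  | succ d ih =>
    rintro x (((rfl | rfl | rfl) | ⟨y, hy, z, hz, rfl⟩) | hx)
    · exact P.one_mem
    · exact hb n
    · exact P.inv_mem (hb n)
    · exact P.mul_mem (ih _ hy) (ih _ hz)
    · simp only [Set.mem_iUnion] at hx
      obtain ⟨i, hi, y, hy, rfl⟩ := hx
      exact P.mul_mem (P.mul_mem (hg i) (ih _ hy)) (P.inv_mem (hg i))

/-- The construction uses only group operations. Applied to evaluation maps `(G → G) →* G`, this
exhibits the elements of an approximation with one variable letter as values of word functions. -/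
theorem image_nbhdApprox (φ : H →* K) (d n : ℕ) :
    φ '' nbhdApprox g b d n = nbhdApprox (φ ∘ g) (φ ∘ b) d n := by
  induction d generalizing n with
  | zero => simp [nbhdApprox]
  | succ d ih =>
    simp only [nbhdApprox, ← ih, Set.image_union, Set.image_iUnion, Set.image_insert_eq,
      Set.image_singleton, Set.image_image, Set.image_image2, Set.image2_image_left,
      Set.image2_image_right, map_mul, map_inv, map_one, Function.comp_apply]

theorem nbhdApprox_congr {b' : ℕ → H} {d n : ℕ} (h : ∀ i < n + d, b i = b' i) :
    nbhdApprox g b d n = nbhdApprox g b' d n := by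
  induction d generalizing n with
  | zero => rfl
  | succ d ih =>
    rw [nbhdApprox, nbhdApprox, ih fun i hi => h i (by omega), h n (by omega)]

/-- Depth `d + 1` brings in only one new letter, `b (n + d)`; if it is trivial, the extra step
yields nothing but `1`. -/
theorem nbhdApprox_succ_eq_of_eq_one {d n : ℕ} (h : b (n + d) = 1) :
    nbhdApprox g b (d + 1) n = nbhdApprox g b d n := by
  induction d generalizing n with
  | zero =>
    rw [add_zero] at h
    refine Set.Subset.antisymm ?_ (nbhdApprox_subset_succ g b 0 n)
    intro x hx
    rcases (by simpa [nbhdApprox, h] using hx : x = 1 ∨ (∃ i, i ≤ n) ∧ x = 1) with rfl | ⟨-, rfl⟩ <;>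
      exact Set.mem_singleton 1
  | succ d ih =>
    rw [nbhdApprox, ih (n := n + 1) (by rwa [add_right_comm]), ← nbhdApprox]

end NbhdApprox

/-! ### Markov's theorem for countable groups -/

section Markov

variable {G : Type*} [Group G]

/-- The values of the `m`-th letter for which an approximate neighborhood contains `c`. -/
theorem isAlgebraicSet_setOf_mem_nbhdApprox (g b : ℕ → G) (x₀ c : G) (m d n : ℕ) :
    IsAlgebraicSet {y | c ∈ nbhdApprox g (Function.update b m (x₀⁻¹ * y)) d n} := by
  let g' : ℕ → G → G := fun i => Function.const G (g i)
  let b' : ℕ → G → G := Function.update (fun i => Function.const G (b i)) m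
    (Function.const G x₀⁻¹ * id)
  have hB (y : G) : nbhdApprox g (Function.update b m (x₀⁻¹ * y)) d n =
      (fun f : G → G => f y) '' nbhdApprox g' b' d n := by
    have h := image_nbhdApprox g' b' (Pi.evalMonoidHom (fun _ : G => G) y) d n
    have hb : (Pi.evalMonoidHom (fun _ : G => G) y) ∘ b' =
        Function.update b m (x₀⁻¹ * y) := by
      ext i
      by_cases hi : i = m
      · subst hi; simp [b']
      · simp [b', hi]
    rw [hb] at h
    exact h.symm
  have hE : {y | c ∈ nbhdApprox g (Function.update b m (x₀⁻¹ * y)) d n} =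
      ⋃ f ∈ nbhdApprox g' b' d n, {y | f y = c} := by
    ext y
    simp [hB]
  rw [hE, ← isClosed_zariskiTopology_iff]
  refine @Set.Finite.isClosed_biUnion _ _ (zariskiTopology G) _ _ (nbhdApprox_finite _ _ _ _)
    fun f hf => isClosed_zariskiTopology_iff.2 (isAlgebraicSet_setOf_wordFunction_eq ?_ c)
  refine nbhdApprox_subset_subgroup g' b' _ (fun i => const_mem_wordFunctions _) (fun i => ?_)
    d n hf
  by_cases hi : i = m
  · subst hi
    simpa [b'] using mul_mem (const_mem_wordFunctions _) id_mem_wordFunctions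
  · simpa [b', hi] using const_mem_wordFunctions _

/-- A choice of letters `x₀⁻¹ * y` with `y ∈ A` for which the approximate neighborhoods
separate the elements of `G` from `1`, if `x₀` is in the Zariski closure of `A`. -/
theorem exists_letters (g : ℕ → G) {A : Set G} {x₀ : G}
    (hx₀ : ∀ E : Set G, IsAlgebraicSet E → A ⊆ E → x₀ ∈ E) :
    ∃ b : ℕ → G, (∀ m, x₀ * b m ∈ A) ∧
      ∀ k d j, j ≤ k → g j ≠ 1 → g j ∉ nbhdApprox g b d k := by
  let Good (m : ℕ) (b : ℕ → G) : Prop :=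
    ∀ k d j, k + d ≤ m → j ≤ k → g j ≠ 1 → g j ∉ nbhdApprox g b d k
  have step (m : ℕ) (b : ℕ → G) (hb : Good m b) :
      ∃ y, x₀ * y ∈ A ∧ Good (m + 1) (Function.update b m y) := by
    -- Only finitely many constraints involve the letters below `m + 1`, so the forbidden values of
    -- `y` form an algebraic set `E`.
    let I : Set (ℕ × ℕ × ℕ) := {p | p.1 + p.2.1 ≤ m + 1 ∧ p.2.2 ≤ p.1 ∧ g p.2.2 ≠ 1}
    have hI : I.Finite := by
      refine ((Set.finite_Iic (m + 1)).prod
        ((Set.finite_Iic (m + 1)).prod (Set.finite_Iic (m + 1)))).subset ?_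
      rintro ⟨k, d, j⟩ ⟨h1, h2, -⟩
      simp only [Set.mem_prod, Set.mem_Iic] at h1 h2 ⊢
      omega
    let E : Set G := ⋃ p ∈ I,
      {y | g p.2.2 ∈ nbhdApprox g (Function.update b m (x₀⁻¹ * y)) p.2.1 p.1}
    have hE : IsAlgebraicSet E := by
      rw [← isClosed_zariskiTopology_iff]
      exact @Set.Finite.isClosed_biUnion _ _ (zariskiTopology G) _ _ hI fun p _ =>
        isClosed_zariskiTopology_iff.2 (isAlgebraicSet_setOf_mem_nbhdApprox _ _ _ _ _ _ _)
    -- At `y = x₀` the new letter is `1`, which reduces every constraint to one already satisfied at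
    -- stage `m`.
    have hxE : x₀ ∉ E := by
      simp only [E, Set.mem_iUnion, not_exists, Set.mem_ofPred_eq, inv_mul_cancel]
      rintro ⟨k, d, j⟩ ⟨h1, h2, h3⟩ h4
      simp only at h1 h2 h3 h4
      have key (d : ℕ) (hd : k + d ≤ m) :
          g j ∉ nbhdApprox g (Function.update b m 1) d k := by
        rw [nbhdApprox_congr g _ (b' := b) fun i hi =>
          Function.update_of_ne (by omega) _ _]
        exact hb k d j hd h2 h3
      rcases h1.lt_or_eq with h1 | h1
      · exact key d (by omega) h4
      · cases d with
        | zero => exact h3 h4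
        | succ d =>
          obtain rfl : m = k + d := by omega
          rw [nbhdApprox_succ_eq_of_eq_one _ _ (by simp)] at h4
          exact key d le_rfl h4
    obtain ⟨y, hyA, hyE⟩ : ∃ y ∈ A, y ∉ E := by
      by_contra! h
      exact hxE (hx₀ E hE h)
    refine ⟨x₀⁻¹ * y, by simpa using hyA, fun k d j h1 h2 h3 h4 => hyE ?_⟩
    exact Set.mem_biUnion (x := (k, d, j)) ⟨h1, h2, h3⟩ h4
  choose! next hnextA hnext using step
  let B : ℕ → ℕ → G := fun m =>
    Nat.rec (fun _ => 1) (fun m b => Function.update b m (next m b)) m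
  have hBsucc (m : ℕ) : B (m + 1) = Function.update (B m) m (next m (B m)) := rfl
  have hB (m : ℕ) : Good m (B m) := by
    induction m with
    | zero =>
      intro k d j h1 _ h3 h4
      obtain rfl : d = 0 := by omega
      exact h3 h4
    | succ m ih => exact hnext m _ ih
  have hBeq (m i : ℕ) (hi : i < m) : B m i = B (i + 1) i := by
    induction m, hi using Nat.le_induction with
    | base => rfl
    | succ m hm ih => rw [hBsucc, Function.update_of_ne (by omega), ih]
  refine ⟨fun m => B (m + 1) m, fun m => ?_, fun k d j h1 h2 h3 => ?_⟩
  · simpa [hBsucc] using hnextA m (B m) (hB m)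
  · rw [nbhdApprox_congr g _ (b' := B (k + d)) fun i hi => (hBeq _ i hi).symm] at h3
    exact hB (k + d) k d j le_rfl h1 h2 h3

/-- The group topology whose neighborhoods of `1` are the unions of the approximate
neighborhoods. -/
@[reducible]
def nbhdGroupFilterBasis (g b : ℕ → G) (hg : Function.Surjective g) : GroupFilterBasis G where
  sets := Set.range fun n => ⋃ d, nbhdApprox g b d n
  nonempty := Set.range_nonempty _
  inter_sets := by
    have anti := antitone_iUnion_nbhdApprox g b
    rintro _ _ ⟨m, rfl⟩ ⟨n, rfl⟩
    exact ⟨_, ⟨max m n, rfl⟩,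
      Set.subset_inter (anti (le_max_left m n)) (anti (le_max_right m n))⟩
  one' := by
    rintro _ ⟨n, rfl⟩
    exact Set.mem_iUnion.2 ⟨0, one_mem_nbhdApprox g b 0 n⟩
  mul' := by
    rintro _ ⟨n, rfl⟩
    refine ⟨_, ⟨n + 1, rfl⟩, ?_⟩
    rintro _ ⟨x, hx, y, hy, rfl⟩
    obtain ⟨d, hx⟩ := Set.mem_iUnion.1 hx
    obtain ⟨e, hy⟩ := Set.mem_iUnion.1 hy
    exact Set.mem_iUnion.2 ⟨max d e + 1, Or.inl (Or.inr
      ⟨x, nbhdApprox_mono g b _ (le_max_left d e) hx,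
        y, nbhdApprox_mono g b _ (le_max_right d e) hy, rfl⟩)⟩
  inv' := by
    rintro _ ⟨n, rfl⟩
    refine ⟨_, ⟨n, rfl⟩, fun x hx => ?_⟩
    obtain ⟨d, hx⟩ := Set.mem_iUnion.1 hx
    exact Set.mem_iUnion.2 ⟨d, inv_mem_nbhdApprox g b hx⟩
  conj' := by
    rintro x₀ _ ⟨n, rfl⟩
    obtain ⟨i, rfl⟩ := hg x₀
    have anti := antitone_iUnion_nbhdApprox g b
    -- Stage `max i n` allows conjugation by `g i`, applied to elements of the next stage.
    refine ⟨_, ⟨max i n + 1, rfl⟩, fun x hx => anti (le_max_right i n) ?_⟩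
    obtain ⟨d, hx⟩ := Set.mem_iUnion.1 hx
    exact Set.mem_iUnion.2 ⟨d + 1, Or.inr (Set.mem_biUnion (le_max_left i n) ⟨x, hx, rfl⟩)⟩

/-- **Markov's theorem**: in a countable group, unconditionally closed sets are algebraic. -/
theorem IsUnconditionallyClosed.isAlgebraicSet [Countable G] {S : Set G}
    (hS : IsUnconditionallyClosed S) : IsAlgebraicSet S := by
  have key : ∀ x₀, (∀ E : Set G, IsAlgebraicSet E → S ⊆ E → x₀ ∈ E) → x₀ ∈ S := by
    intro x₀ hx₀
    obtain ⟨g, hg⟩ := exists_surjective_nat G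
    obtain ⟨b, hbS, hb⟩ := exists_letters g hx₀
    let F := nbhdGroupFilterBasis g b hg
    have hT2 : @T2Space G F.topology := by
      refine (@GroupFilterBasis.t2Space_iff_sInter_subset G _ F.topology F rfl).2 fun x hx => ?_
      obtain ⟨j, rfl⟩ := hg x
      by_contra hj
      obtain ⟨d, hd⟩ := Set.mem_iUnion.1 (hx _ ⟨j, rfl⟩)
      exact hb j d j le_rfl hj hd
    have hcl := hS F.topology ⟨F.isTopologicalGroup, hT2⟩
    rw [← @closure_eq_iff_isClosed _ F.topology] at hcl
    rw [← hcl, @mem_closure_iff_nhds_basis' _ F.topology _ _ _ _ _ (F.nhds_hasBasis x₀)]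
    rintro _ ⟨n, rfl⟩
    refine ⟨x₀ * b n, ⟨b n, Set.mem_iUnion.2 ⟨1, ?_⟩, rfl⟩, hbS n⟩
    simp [nbhdApprox]
  have hS' : S = ⋂₀ {E | IsAlgebraicSet E ∧ S ⊆ E} :=
    Set.Subset.antisymm (Set.subset_sInter fun E hE => hE.2)
      fun x hx => key x fun E hE hSE => hx E ⟨hE, hSE⟩
  rw [hS']
  exact isAlgebraicSet_sInter _ fun E hE => hE.1

end Markov

/-! ### Reflection to a countable Markov embedded subgroup -/

section Reflection

/-- The elementary algebraic subsets of `G` defined by an equation with coefficients in `T`. -/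
def elementaryAlgebraicOver {G : Type*} [Group G] (T : Set G) : Set (Set G) :=
  {S | ∃ (n : ℕ) (a : Fin (n + 1) → G) (ε : Fin (n + 1) → ℤ),
    (∀ i, a i ∈ T) ∧ (∀ i, ε i = 1 ∨ ε i = -1) ∧
    S = {x : G | (List.ofFn fun i : Fin n => x ^ ε i.castSucc * a i.castSucc).prod *
      x ^ ε (Fin.last n) = a (Fin.last n)}}

variable {G : Type*} [Group G]

theorem elementaryAlgebraicOver_mono {T T' : Set G} (h : T ⊆ T') :
    elementaryAlgebraicOver T ⊆ elementaryAlgebraicOver T' := by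
  rintro S ⟨n, a, ε, ha, hS⟩
  exact ⟨n, a, ε, fun i => h (ha i), hS⟩

theorem isElementaryAlgebraic_of_mem_elementaryAlgebraicOver {T S : Set G}
    (h : S ∈ elementaryAlgebraicOver T) : IsElementaryAlgebraic S := by
  obtain ⟨n, a, ε, -, hS⟩ := h
  exact ⟨n, a, ε, hS⟩

theorem countable_elementaryAlgebraicOver {T : Set G} (hT : T.Countable) :
    (elementaryAlgebraicOver T).Countable := by
  have := hT.to_subtype
  refine (Set.countable_range fun p : Σ n : ℕ, (Fin (n + 1) → T) × (Fin (n + 1) → ℤ) =>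
    {x : G | (List.ofFn fun i : Fin p.1 => x ^ p.2.2 i.castSucc * (p.2.1 i.castSucc : G)).prod *
      x ^ p.2.2 (Fin.last p.1) = p.2.1 (Fin.last p.1)}).mono ?_
  rintro S ⟨n, a, ε, ha, -, rfl⟩
  exact ⟨⟨n, fun i => ⟨a i, ha i⟩, ε⟩, rfl⟩

theorem elementaryAlgebraicOver_iUnion_subset {Y : ℕ → Set G} (hY : Monotone Y) :
    elementaryAlgebraicOver (⋃ k, Y k) ⊆ ⋃ k, elementaryAlgebraicOver (Y k) := by
  rintro S ⟨n, a, ε, ha, hS⟩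
  simp only [Set.mem_iUnion] at ha
  choose k hk using ha
  exact Set.mem_iUnion.2 ⟨Finset.univ.sup k, n, a, ε,
    fun i => hY (Finset.le_sup (Finset.mem_univ i)) (hk i), hS⟩

theorem exists_mem_elementaryAlgebraicOver_preimage (N : Subgroup G) {E : Set N}
    (hE : IsElementaryAlgebraic E) :
    ∃ E' ∈ elementaryAlgebraicOver (N : Set G), Subtype.val ⁻¹' E' = E := by
  obtain ⟨n, a, ε, hε, rfl⟩ := hE
  refine ⟨_, ⟨n, fun i => a i, ε, fun i => (a i).2, hε, rfl⟩, ?_⟩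
  ext x
  have h : ((List.ofFn fun i : Fin n => x ^ ε i.castSucc * a i.castSucc).prod : G) =
      (List.ofFn fun i : Fin n => (x : G) ^ ε i.castSucc * (a i.castSucc : G)).prod := by
    rw [← Subgroup.coe_subtype, map_list_prod, List.map_ofFn]
    rfl
  rw [Set.mem_preimage, Set.mem_ofPred_eq, Set.mem_ofPred_eq, Subtype.ext_iff, Subgroup.coe_mul, h,
    Subgroup.coe_zpow]

/-- Every club of countable sets contains a set that is closed under a given assignment of points
to finite families of elementary algebraic sets with coefficients in it. -/
theorem IsClubOfCountableSets.exists_closed_under {C : Set (Set G)}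
    (hC : IsClubOfCountableSets C) (w : Set (Set G) → G) (x : G) :
    ∃ Z ∈ C, x ∈ Z ∧ ∀ F : Set (Set G), F.Finite → F ⊆ elementaryAlgebraicOver Z → w F ∈ Z := by
  let Φ (Y : Set G) : Set G := w '' {F | F.Finite ∧ F ⊆ elementaryAlgebraicOver Y}
  have hΦ (Y : Set G) (hY : Y.Countable) : (Φ Y).Countable :=
    (Set.countable_ofPred_finite_subset (countable_elementaryAlgebraicOver hY)).image _
  have step (Y : Set G) (hY : Y ∈ C) : ∃ Z ∈ C, Y ∪ Φ Y ⊆ Z :=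
    hC.unbounded _ ((hC.countable Y hY).union (hΦ Y (hC.countable Y hY)))
  choose! next hnextC hnext using step
  obtain ⟨Y₀, hY₀, hx⟩ := hC.unbounded {x} (Set.countable_singleton x)
  let Y : ℕ → Set G := fun k => next^[k] Y₀
  have hYsucc (k : ℕ) : Y (k + 1) = next (Y k) := Function.iterate_succ_apply' _ _ _
  have hYC (k : ℕ) : Y k ∈ C := by
    induction k with
    | zero => exact hY₀
    | succ k ih => rw [hYsucc]; exact hnextC _ ih
  have hsub (k : ℕ) : Y k ∪ Φ (Y k) ⊆ Y (k + 1) := by rw [hYsucc]; exact hnext _ (hYC k)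
  have hmono : Monotone Y :=
    monotone_nat_of_le_succ fun k => Set.subset_union_left.trans (hsub k)
  refine ⟨⋃ k, Y k, hC.closed Y hYC fun k => hmono k.le_succ,
    Set.mem_iUnion.2 ⟨0, hx rfl⟩, fun F hF hFsub => ?_⟩
  -- A finite family uses finitely many coefficients, so it already lives over some `Y k`, and its
  -- value under `w` enters at `Y (k + 1)`.
  have hdir : Directed (· ⊆ ·) fun k => elementaryAlgebraicOver (Y k) :=
    Monotone.directed_le fun _ _ h => elementaryAlgebraicOver_mono (hmono h)
  obtain ⟨k, hk⟩ := hdir.exists_mem_subset_of_finset_subset_biUnion (s := hF.toFinset)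
    (by simpa using hFsub.trans (elementaryAlgebraicOver_iUnion_subset hmono))
  exact Set.mem_iUnion.2 ⟨k + 1, hsub k (Or.inr ⟨F, ⟨hF, by simpa using hk⟩, rfl⟩)⟩

theorem IsUnconditionallyClosed.isAlgebraicSet_of_club {C : Set (Set G)}
    (hC : IsClubOfCountableSets C) (hCG : C ⊆ countableMarkovEmbedded G) {S : Set G}
    (hS : IsUnconditionallyClosed S) : IsAlgebraicSet S := by
  refine ⟨{E | IsFiniteUnionOfElementaryAlgebraic E ∧ S ⊆ E}, fun E hE => hE.1,
    Set.Subset.antisymm (Set.subset_sInter fun E hE => hE.2) fun x hx => ?_⟩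
  by_contra hxS
  -- The conditions on `F` sit inside the existential so that `w` is total.
  have hw (F : Set (Set G)) : ∃ s, F.Finite → (∀ E ∈ F, IsElementaryAlgebraic E) →
      x ∉ ⋃₀ F → s ∈ S ∧ s ∉ ⋃₀ F := by
    by_contra! h
    obtain ⟨hF, hF', hxF, -⟩ := h 1
    exact hxF (hx _ ⟨⟨F, hF, hF', rfl⟩, fun s hs => (h s).2.2.2 hs⟩)
  choose w hw using hw
  obtain ⟨Z, hZC, hxZ, hZ⟩ := hC.exists_closed_under w x
  obtain ⟨hZc, N, rfl, hN⟩ := hCG hZC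
  have : Countable N := hZc.to_subtype
  -- The only use of Markov embeddedness: the trace of `S` is unconditionally closed in `N`.
  have hSN : @IsClosed N (markovTopology N) (Subtype.val ⁻¹' S : Set N) := by
    rw [show markovTopology N = _ from hN]
    exact (@isClosed_induced_iff _ _ (markovTopology G) _ _).2
      ⟨S, isClosed_markovTopology_iff.2 hS, rfl⟩
  obtain ⟨A, hA, hSA⟩ := (isClosed_markovTopology_iff.1 hSN).isAlgebraicSet
  have hxA : (⟨x, hxZ⟩ : N) ∉ ⋂₀ A := by rw [← hSA]; exact hxS
  simp only [Set.mem_sInter, not_forall] at hxA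
  obtain ⟨E, hEA, hxE⟩ := hxA
  obtain ⟨F, hF, hF', rfl⟩ := hA E hEA
  choose! e he hpre using fun E hE => exists_mem_elementaryAlgebraicOver_preimage N (hF' E hE)
  have hmem (y : N) : (y : G) ∈ ⋃₀ (e '' F) ↔ y ∈ ⋃₀ F := by
    simp only [Set.mem_sUnion, Set.exists_mem_image]
    refine exists_congr fun E => and_congr_right fun hE => ?_
    conv_rhs => rw [← hpre E hE]
    rfl
  have heN : e '' F ⊆ elementaryAlgebraicOver (N : Set G) := by
    rintro _ ⟨E, hE, rfl⟩
    exact he E hE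
  obtain ⟨hwS, hwF⟩ := hw (e '' F) (hF.image e)
    (fun E hE => isElementaryAlgebraic_of_mem_elementaryAlgebraicOver (heN hE))
    fun h => hxE ((hmem ⟨x, hxZ⟩).1 h)
  have hwN : w (e '' F) ∈ N := hZ _ (hF.image e) heN
  refine hwF ((hmem ⟨_, hwN⟩).2 ?_)
  have hmemS : (⟨_, hwN⟩ : N) ∈ (Subtype.val ⁻¹' S : Set N) := hwS
  rw [hSA] at hmemS
  exact hmemS _ hEA

end Reflection

theorem corollary4p3 {G : Type*} [Group G]
    (h : ∃ C : Set (Set G), IsClubOfCountableSets C ∧ C ⊆ countableMarkovEmbedded G) :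
    markovTopology G = zariskiTopology G := by
  obtain ⟨C, hC, hCG⟩ := h
  refine TopologicalSpace.ext_isClosed fun S => ?_
  rw [isClosed_markovTopology_iff, isClosed_zariskiTopology_iff]
  exact ⟨fun hS => hS.isAlgebraicSet_of_club hC hCG, fun hS => hS.isUnconditionallyClosed⟩
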